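/- Let $t_0<t_1$, $0<a<b<1$ and $a_0\in\mathbb{R}$, and let $\alpha:\mathbb{R}\to[a,b]$ be continuously differentiable with bounded derivative. Write $r^{\langle s\rangle}=\operatorname{sign}(r)|r|^{s}$. Let $\Pi\subset(t_0,t_1)\times\mathbb{R}$ be a Poisson point process whose mean measure is plane Lebesgue measure. Let $Z$ be the real-valued random process on $[t_0,t_1)$ driven by $\Pi$, that is, almost surely the sample paths of $Z$ are right continuous on $[t_0,t_1)$ with left limits at every point of $(t_0,t_1]$, and $$Z(t)=a_0+\sum_{(x,y)\in\Pi}1_{(t_0,t]}(x)\,y^{\langle -1/\alpha(Z(x_-))\rangle}\qquad(t_0\le t<t_1),$$ with absolutely convergent sums, where $Z(x_-)=\lim_{s\nearrow x}Z(s)$. Let $0<\epsilon<1/b$. Then for each $t\in[t_0,t_1)$ there is a random variable $C>0$ such that, almost surely, for all $0<h<t_1-t$, $$|Z(t+h)-Z(t)|\le C\,h^{1/\alpha(Z(t))-\epsilon}.$$ -/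

import Mathlib

open MeasureTheory ProbabilityTheory Filter Topology Set
open scoped ENNReal

/-- The signed power `r^⟨s⟩ = sign(r) |r|^s`. -/
noncomputable def signedPow (r s : ℝ) : ℝ := Real.sign r * |r| ^ s

/-- The Poisson distribution with mean `m ∈ [0, ∞]`, as a law on `{0, 1, 2, …, ∞}`;
for `m = ∞` it is the point mass at `∞`. -/
noncomputable def poissonLaw (m : ℝ≥0∞) : Measure ℕ∞ :=
  if m = ∞ then Measure.dirac ⊤
  else (poissonMeasure m.toNNReal).map (fun k : ℕ => (k : ℕ∞))

/-- `N(A)(ω)`: the number of points of the random set `X` in `A`. -/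
noncomputable def pointCount {Ω E : Type*} (X : Ω → Set E) (A : Set E) (ω : Ω) : ℕ∞ :=
  (X ω ∩ A).encard

/-- `X` is a Poisson point process on `S` with mean measure `μ` (restricted to `S`): a random
subset of `S` whose numbers of points in measurable sets `A ⊆ S` are random variables, Poisson
distributed with mean `μ A`, and independent for disjoint sets. -/
structure IsPoissonPointProcess {Ω E : Type*} [MeasurableSpace Ω] [MeasurableSpace E]
    (P : Measure Ω) (X : Ω → Set E) (S : Set E) (μ : Measure E) : Prop where
  subset : ∀ ω, X ω ⊆ S
  measurable_count : ∀ A : Set E, MeasurableSet A → A ⊆ S → Measurable (pointCount X A)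
  law_count : ∀ A : Set E, MeasurableSet A → A ⊆ S →
    P.map (pointCount X A) = poissonLaw (μ A)
  indep_count : ∀ (n : ℕ) (A : Fin n → Set E), (∀ i, MeasurableSet (A i)) → (∀ i, A i ⊆ S) →
    Pairwise (fun i j => Disjoint (A i) (A j)) → iIndepFun (fun i => pointCount X (A i)) P

/-- `f ∈ D[t₀, t₁)`: right continuous on `[t₀, t₁)`, with left limits at every point of
`(t₀, t₁]` (`t₁` included). Values of `f` outside `[t₀, t₁)` play no role. -/
def IsCadlagOn (t₀ t₁ : ℝ) (f : ℝ → ℝ) : Prop :=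
  (∀ u ∈ Ico t₀ t₁, Tendsto f (𝓝[>] u) (𝓝 (f u))) ∧
    ∀ u ∈ Ioc t₀ t₁, ∃ l : ℝ, Tendsto f (𝓝[<] u) (𝓝 l)

/-- For `t ∈ [t₀, t₁)`,
`f(t) = a₀ + ∑_{(x,y) ∈ S} 1_{(t₀,t]}(x) y^⟨-1/α(f(x₋))⟩`, the series converging absolutely. -/
def SolvesJumpEquation (t₀ t₁ a₀ : ℝ) (α : ℝ → ℝ) (S : Set (ℝ × ℝ)) (f : ℝ → ℝ) : Prop :=
  ∀ t ∈ Ico t₀ t₁,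
    HasSum (fun p : S => (Ioc t₀ t).indicator
      (fun x => signedPow p.1.2 (-1 / α (Function.leftLim f x))) p.1.1) (f t - a₀)

/-- `Z` is the self-stabilizing process on `[t₀, t₁)` started at `a₀` and driven by the random
point set `X`: a real random process that almost surely has its paths in `D[t₀, t₁)` and
solves the jump equation. -/
structure IsSelfStabilizingProcess {Ω : Type*} [MeasurableSpace Ω] (P : Measure Ω)
    (t₀ t₁ a₀ : ℝ) (α : ℝ → ℝ) (X : Ω → Set (ℝ × ℝ)) (Z : ℝ → Ω → ℝ) : Prop where
  measurable : ∀ t ∈ Ico t₀ t₁, Measurable (Z t)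
  cadlag : ∀ᵐ ω ∂P, IsCadlagOn t₀ t₁ (fun t => Z t ω)
  solves : ∀ᵐ ω ∂P, SolvesJumpEquation t₀ t₁ a₀ α (X ω) (fun t => Z t ω)

/-! For `η > 0` and `γ > 1` the weight `w(x,y) = (x-t)^(-(1-η)) (1+|y|)^(-γ)` is integrable on `t <
x < t₁`, so by Campbell's formula its sum `M` over the random points is a.s. finite. A point with `t
< x ≤ t+h` then has `(1+|y|)^(-γ) ≤ h^(1-η) w ≤ h^(1-η) M`: early jumps come from large `|y|`. By
right continuity the jump exponents just after `t` are at least `qγ` for any `qγ < 1/α(Z(t))`, so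
each jump is at most a constant times `(h^(1-η) M)^(q-1) h^(1-η) w`, and summing gives
`O(h^((1-η)q))` (`abs_jump_le`, `exists_local_bound`). Letting `η → 0`, `γ → 1` and `q → 1/α(Z(t))`
loses less than `ε`. Boundedness of the paths handles large `h`, and a supremum over rational `h`
makes the constant measurable. -/

/-! ### Poisson means and Campbell's formula -/

lemma lintegral_natCast_poissonMeasure (r : NNReal) :
    ∫⁻ n : ℕ, (n : ℝ≥0∞) ∂(poissonMeasure r) = r := by
  have h1 : ∀ n : ℕ, ENNReal.ofReal (Real.exp (-r) * r ^ (n + 1) / (n + 1).factorial) *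
      ((n + 1 : ℕ) : ℝ≥0∞) = r * ENNReal.ofReal (Real.exp (-r) * r ^ n / n.factorial) := by
    intro n
    rw [← ENNReal.ofReal_natCast, ← ENNReal.ofReal_mul (by positivity),
      ← ENNReal.ofReal_coe_nnreal, ← ENNReal.ofReal_mul (by positivity)]
    congr 1
    rw [Nat.factorial_succ]
    push_cast
    field_simp
    ring
  have h2 : ∑' n : ℕ, ENNReal.ofReal (Real.exp (-r) * r ^ n / n.factorial) = 1 := by
    rw [← ENNReal.ofReal_tsum_of_nonneg (fun n => by positivity)
      (hasSum_one_poissonMeasure r).summable, (hasSum_one_poissonMeasure r).tsum_eq,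
      ENNReal.ofReal_one]
  rw [poissonMeasure, lintegral_sum_measure]
  simp_rw [lintegral_smul_measure, lintegral_dirac, smul_eq_mul]
  rw [tsum_eq_zero_add' ENNReal.summable]
  simp_rw [h1, ENNReal.tsum_mul_left, h2]
  simp

lemma lintegral_toENNReal_poissonLaw (m : ℝ≥0∞) :
    ∫⁻ k : ℕ∞, (k : ℝ≥0∞) ∂(poissonLaw m) = m := by
  unfold poissonLaw
  split_ifs with h
  · simp [h]
  · rw [lintegral_map .of_discrete .of_discrete]
    simp only [ENat.toENNReal_coe, lintegral_natCast_poissonMeasure]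
    exact ENNReal.coe_toNNReal h

lemma tsum_subtype_indicator_const {E : Type*} (s A : Set E) (c : ℝ≥0∞) :
    ∑' p : s, A.indicator (fun _ => c) p.1 = c * ((s ∩ A).encard : ℝ≥0∞) := by
  rw [tsum_subtype s (A.indicator fun _ => c), indicator_indicator,
    ← tsum_subtype (s ∩ A) (fun _ => c), ENNReal.tsum_set_const, mul_comm]

section Campbell

variable {Ω E : Type*} [MeasurableSpace Ω] [MeasurableSpace E] {P : Measure Ω}
  {X : Ω → Set E} {S : Set E} {μ : Measure E}

lemma IsPoissonPointProcess.pointCount_inter (hX : IsPoissonPointProcess P X S μ) (A : Set E) :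
    pointCount X (A ∩ S) = pointCount X A := by
  funext ω
  unfold pointCount
  congr 1
  ext p
  have := @hX.subset ω p
  simp only [mem_inter_iff]
  tauto

lemma IsPoissonPointProcess.measurable_pointCount (hX : IsPoissonPointProcess P X S μ)
    (hS : MeasurableSet S) {A : Set E} (hA : MeasurableSet A) : Measurable (pointCount X A) :=
  hX.pointCount_inter A ▸ hX.measurable_count _ (hA.inter hS) inter_subset_right

lemma IsPoissonPointProcess.lintegral_pointCount (hX : IsPoissonPointProcess P X S μ)
    (hS : MeasurableSet S) {A : Set E} (hA : MeasurableSet A) :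
    ∫⁻ ω, (pointCount X A ω : ℝ≥0∞) ∂P = μ.restrict S A := by
  rw [Measure.restrict_apply hA, ← hX.pointCount_inter A,
    ← lintegral_toENNReal_poissonLaw (μ (A ∩ S)),
    ← hX.law_count _ (hA.inter hS) inter_subset_right,
    lintegral_map .of_discrete (hX.measurable_count _ (hA.inter hS) inter_subset_right)]

/-- Campbell's formula for nonnegative functions. -/
lemma IsPoissonPointProcess.campbell [MeasurableSingletonClass E]
    (hX : IsPoissonPointProcess P X S μ)
    (hS : MeasurableSet S) {f : E → ℝ≥0∞} (hf : Measurable f) :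
    Measurable (fun ω => ∑' p : X ω, f p) ∧
      ∫⁻ ω, ∑' p : X ω, f p ∂P = ∫⁻ p, f p ∂(μ.restrict S) := by
  refine Measurable.ennreal_induction
    (motive := fun f => Measurable (fun ω => ∑' p : X ω, f p) ∧
      ∫⁻ ω, ∑' p : X ω, f p ∂P = ∫⁻ p, f p ∂(μ.restrict S)) ?_ ?_ ?_ hf
  · intro c A hA
    have hm : Measurable fun ω => (pointCount X A ω : ℝ≥0∞) :=
      Measurable.of_discrete.comp (hX.measurable_pointCount hS hA)
    simp_rw [tsum_subtype_indicator_const]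
    exact ⟨hm.const_mul c, (lintegral_const_mul c hm).trans <| by
      rw [hX.lintegral_pointCount hS hA, lintegral_indicator_const hA]⟩
  · intro f g _ hf hg ihf ihg
    simp_rw [Pi.add_apply, ENNReal.summable.tsum_add ENNReal.summable]
    exact ⟨ihf.1.add ihg.1, by rw [lintegral_add_left ihf.1, lintegral_add_left hf, ihf.2, ihg.2]⟩
  · intro f hf hmono ih
    -- Monotone convergence for counting measure on the subtype `X ω`.
    have key : ∀ ω, ∑' p : X ω, ⨆ n, f n p = ⨆ n, ∑' p : X ω, f n p := by
      intro ω
      simp_rw [← lintegral_count]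
      exact lintegral_iSup (fun n => (hf n).comp measurable_subtype_coe)
        (fun m n hmn p => hmono hmn p.1)
    simp_rw [key]
    refine ⟨Measurable.iSup fun n => (ih n).1, ?_⟩
    rw [lintegral_iSup (fun n => (ih n).1)
      (fun m n hmn ω => ENNReal.tsum_le_tsum fun p => hmono hmn p.1), lintegral_iSup hf hmono]
    simp_rw [(ih _).2]

end Campbell

/-! ### The weight and its sum over the points -/

/-- The weight `(x - t)^(-(1-η)) (1+|y|)^(-γ)` on points `(x, y)` with `t < x < t₁`. -/
noncomputable def pointWeight (t t₁ η γ : ℝ) (p : ℝ × ℝ) : ℝ :=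
  (Ioo t t₁).indicator (fun x => (x - t) ^ (-(1 - η))) p.1 * (1 + |p.2|) ^ (-γ)

lemma pointWeight_nonneg (t t₁ η γ : ℝ) (p : ℝ × ℝ) : 0 ≤ pointWeight t t₁ η γ p := by
  refine mul_nonneg (indicator_nonneg (fun x hx => ?_) _) (by positivity)
  exact Real.rpow_nonneg (sub_nonneg.2 hx.1.le) _

lemma integrable_pointWeight {t t₁ η γ : ℝ} (hη : 0 < η) (hγ : 1 < γ) :
    Integrable (pointWeight t t₁ η γ) (volume : Measure (ℝ × ℝ)) := by
  refine Integrable.mul_prod (f := (Ioo t t₁).indicator fun x => (x - t) ^ (-(1 - η)))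
    (g := fun y => (1 + |y|) ^ (-γ)) ?_ ?_
  · rw [integrable_indicator_iff measurableSet_Ioo]
    rcases le_total t t₁ with h | h
    · have := (intervalIntegral.intervalIntegrable_rpow' (r := -(1 - η)) (a := 0)
        (b := t₁ - t) (by linarith)).comp_sub_right t
      rw [zero_add, sub_add_cancel, intervalIntegrable_iff_integrableOn_Ioo_of_le h] at this
      exact this
    · simp [Ioo_eq_empty (not_lt.2 h)]
  · exact integrable_one_add_norm (E := ℝ) (by simpa using hγ)

lemma ae_summable_pointWeight {Ω : Type*} [MeasurableSpace Ω] {P : Measure Ω}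
    {X : Ω → Set (ℝ × ℝ)} {S : Set (ℝ × ℝ)} (hX : IsPoissonPointProcess P X S volume)
    (hS : MeasurableSet S) {t t₁ η γ : ℝ} (hη : 0 < η) (hγ : 1 < γ) :
    ∀ᵐ ω ∂P, Summable fun p : X ω => pointWeight t t₁ η γ p := by
  have hm : Measurable (pointWeight t t₁ η γ) := by
    unfold pointWeight
    refine Measurable.mul (Measurable.comp (Measurable.indicator (by fun_prop)
      measurableSet_Ioo) measurable_fst) (by fun_prop)
  have hc := hX.campbell hS hm.ennreal_ofReal
  have hfin : ∫⁻ p, ENNReal.ofReal (pointWeight t t₁ η γ p) ∂(volume.restrict S) ≠ ∞ :=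
    ((integrable_pointWeight hη hγ).restrict).lintegral_lt_top.ne
  rw [← hc.2] at hfin
  filter_upwards [ae_lt_top hc.1 hfin] with ω hω
  have := ENNReal.summable_toReal hω.ne
  simpa only [ENNReal.toReal_ofReal (pointWeight_nonneg _ _ _ _ _)] using this

/-! ### Jump sizes and the bound for small `h` -/

lemma abs_signedPow_le (r s : ℝ) : |signedPow r s| ≤ |r| ^ s := by
  rw [signedPow, abs_mul, abs_of_nonneg (Real.rpow_nonneg (abs_nonneg r) s)]
  refine mul_le_of_le_one_left (Real.rpow_nonneg (abs_nonneg r) s) ?_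
  rcases Real.sign_apply_eq r with h | h | h <;> simp [h]

/-- If `(1+|y|)^(-γ) ≤ v < 2^(-γ)` and `q ≥ 1`, then `|y|^(-s) ≤ 2^(qγ) v^(q-1) (1+|y|)^(-γ)`
for all `s ≥ qγ`. -/
lemma rpow_neg_le_of_one_add_rpow_le {y v γ q s : ℝ} (hγ : 0 < γ) (hq : 1 ≤ q)
    (hs : q * γ ≤ s) (hc : (1 + |y|) ^ (-γ) ≤ v) (hv : v < 2 ^ (-γ)) :
    |y| ^ (-s) ≤ 2 ^ (q * γ) * (v ^ (q - 1) * (1 + |y|) ^ (-γ)) := by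
  -- The bound `v < 2^(-γ)` forces `1 + |y| > 2`, hence also `(1+|y|)/2 ≤ |y|`.
  have hy : 1 < |y| := by
    have := (Real.rpow_lt_rpow_iff_of_neg (by positivity) (by norm_num) (neg_lt_zero.2 hγ)).1
      (hc.trans_lt hv)
    linarith
  have hpos : 0 < (1 + |y|) ^ (-γ) := by positivity
  calc |y| ^ (-s) ≤ |y| ^ (-(q * γ)) := Real.rpow_le_rpow_of_exponent_le hy.le (by linarith)
    _ ≤ ((1 + |y|) / 2) ^ (-(q * γ)) :=
        Real.rpow_le_rpow_of_nonpos (by positivity) (by linarith)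
          (neg_nonpos.2 (by positivity))
    _ = 2 ^ (q * γ) * ((1 + |y|) ^ (-γ)) ^ q := by
        rw [Real.div_rpow (by positivity) (by norm_num),
          ← Real.rpow_mul (by positivity : (0 : ℝ) ≤ 1 + |y|),
          Real.rpow_neg (zero_le_two : (0 : ℝ) ≤ 2) (q * γ), div_inv_eq_mul, mul_comm]
        congr 2
        ring
    _ = 2 ^ (q * γ) * (((1 + |y|) ^ (-γ)) ^ (q - 1) * (1 + |y|) ^ (-γ)) := by
        rw [← Real.rpow_add_one hpos.ne', sub_add_cancel]
    _ ≤ _ := by gcongr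

/-- Of the `q` powers of `(1+|y|)^(-γ)`, `q - 1` are bounded through `M` and one keeps the weight,
so that the bound remains summable over the points. -/
lemma abs_jump_le {t t₁ η γ q M h s : ℝ} {p : ℝ × ℝ} (hη : η < 1) (hγ : 0 < γ) (hq : 1 ≤ q)
    (hM : pointWeight t t₁ η γ p ≤ M) (hx : p.1 ∈ Ioc t (t + h)) (ht₁ : t + h < t₁)
    (hv : h ^ (1 - η) * M < 2 ^ (-γ)) (hs : q * γ ≤ s) :
    |signedPow p.2 (-s)| ≤
      2 ^ (q * γ) * ((h ^ (1 - η) * M) ^ (q - 1) * h ^ (1 - η)) * pointWeight t t₁ η γ p := by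
  have hxt : 0 < p.1 - t := sub_pos.2 hx.1
  have hh : 0 < h := by linarith [hx.2]
  have hM0 : 0 ≤ M := (pointWeight_nonneg _ _ _ _ _).trans hM
  have hw : (1 + |p.2|) ^ (-γ) ≤ h ^ (1 - η) * pointWeight t t₁ η γ p := by
    have hmem : p.1 ∈ Ioo t t₁ := ⟨hx.1, hx.2.trans_lt ht₁⟩
    calc (1 + |p.2|) ^ (-γ) = (p.1 - t) ^ (1 - η) * pointWeight t t₁ η γ p := by
          rw [pointWeight, indicator_of_mem hmem, ← mul_assoc, ← Real.rpow_add hxt]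
          simp
      _ ≤ _ := mul_le_mul_of_nonneg_right
          (Real.rpow_le_rpow hxt.le (by linarith [hx.2]) (by linarith))
          (pointWeight_nonneg _ _ _ _ _)
  have hc : (1 + |p.2|) ^ (-γ) ≤ h ^ (1 - η) * M :=
    hw.trans (by gcongr)
  calc _ ≤ |p.2| ^ (-s) := abs_signedPow_le _ _
    _ ≤ 2 ^ (q * γ) * ((h ^ (1 - η) * M) ^ (q - 1) * (1 + |p.2|) ^ (-γ)) :=
        rpow_neg_le_of_one_add_rpow_le hγ hq hs hc hv
    _ ≤ 2 ^ (q * γ) * ((h ^ (1 - η) * M) ^ (q - 1) *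
          (h ^ (1 - η) * pointWeight t t₁ η γ p)) := by gcongr
    _ = _ := by ring

lemma SolvesJumpEquation.hasSum_sub {t₀ t₁ a₀ : ℝ} {α : ℝ → ℝ} {S : Set (ℝ × ℝ)} {f : ℝ → ℝ}
    (hf : SolvesJumpEquation t₀ t₁ a₀ α S f) {s t : ℝ} (hs : t₀ ≤ s) (hst : s ≤ t)
    (ht : t < t₁) :
    HasSum (fun p : S => (Ioc s t).indicator
      (fun x => signedPow p.1.2 (-1 / α (Function.leftLim f x))) p.1.1) (f t - f s) := by
  convert! (hf t ⟨hs.trans hst, ht⟩).sub (hf s ⟨hs, hst.trans_lt ht⟩) using 1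
  · funext p
    have := Ioc_union_Ioc_eq_Ioc hs hst
    have hd : Disjoint (Ioc t₀ s) (Ioc s t) := Ioc_disjoint_Ioc_of_le le_rfl
    rw [← this, indicator_union_of_disjoint hd, add_sub_cancel_left]
  · ring

/-- Left limits at points just after `t` are limits of values taken after `t`, which right
continuity controls; strictness is lost in the limit. -/
lemma IsCadlagOn.lt_inv_leftLim {t₀ t₁ : ℝ} {α f : ℝ → ℝ} (hf : IsCadlagOn t₀ t₁ f)
    (hα : Continuous α) (hpos : ∀ x, 0 < α x) {t r : ℝ} (ht : t ∈ Ico t₀ t₁)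
    (hr : r < 1 / α (f t)) :
    ∃ δ > 0, ∀ x ∈ Ioo t (t + δ), x ≤ t₁ → r ≤ 1 / α (Function.leftLim f x) := by
  have hcont : Continuous fun z => 1 / α z :=
    continuous_const.div hα fun z => (hpos z).ne'
  have h1 : ∀ᶠ u in 𝓝[>] t, r < 1 / α (f u) :=
    ((hcont.tendsto _).comp (hf.1 t ht)).eventually_const_lt hr
  obtain ⟨v, hv, hsub⟩ := mem_nhdsGT_iff_exists_Ioo_subset.1 h1
  refine ⟨v - t, sub_pos.2 hv, fun x hx hx₁ => ?_⟩
  rw [add_sub_cancel] at hx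
  obtain ⟨l, hl⟩ := hf.2 x ⟨ht.1.trans_lt hx.1, hx₁⟩
  rw [leftLim_eq_of_tendsto hl]
  refine ge_of_tendsto ((hcont.tendsto _).comp hl) ?_
  filter_upwards [Ioo_mem_nhdsLT hx.1] with u hu
  exact (hsub ⟨hu.1, hu.2.trans hx.2⟩).le

lemma SolvesJumpEquation.exists_local_bound {t₀ t₁ a₀ : ℝ} {α : ℝ → ℝ} {S : Set (ℝ × ℝ)}
    {f : ℝ → ℝ} (hf : SolvesJumpEquation t₀ t₁ a₀ α S f) (hc : IsCadlagOn t₀ t₁ f)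
    (hα : Continuous α) (hpos : ∀ x, 0 < α x) {t η γ q : ℝ} (ht : t ∈ Ico t₀ t₁)
    (hη : η < 1) (hγ : 0 < γ) (hq : 1 ≤ q) (hr : q * γ < 1 / α (f t))
    (hsum : Summable fun p : S => pointWeight t t₁ η γ p) :
    ∃ C, ∃ δ > 0, ∀ h, 0 < h → h < δ → |f (t + h) - f t| ≤ C * h ^ ((1 - η) * q) := by
  set M := ∑' p : S, pointWeight t t₁ η γ p with hMdef
  have hM0 : 0 ≤ M := tsum_nonneg fun p => pointWeight_nonneg _ _ _ _ _
  have hwM : ∀ p : S, pointWeight t t₁ η γ p ≤ M := fun p =>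
    hsum.le_tsum p fun _ _ => pointWeight_nonneg _ _ _ _ _
  obtain ⟨δ₁, hδ₁, h₁⟩ := hc.lt_inv_leftLim hα hpos ht hr
  have hlim : Tendsto (fun h : ℝ => h ^ (1 - η) * M) (𝓝 0) (𝓝 0) := by
    have := ((Real.continuousAt_rpow_const (0 : ℝ) (1 - η) (.inr (by linarith))).mul
      continuousAt_const : ContinuousAt (fun h : ℝ => h ^ (1 - η) * M) 0)
    simpa [ContinuousAt, Real.zero_rpow (sub_pos.2 hη).ne', Pi.mul_def] using this
  obtain ⟨δ₂, hδ₂, h₂⟩ := Metric.eventually_nhds_iff.1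
    (hlim.eventually_lt_const (show (0 : ℝ) < 2 ^ (-γ) by positivity))
  refine ⟨2 ^ (q * γ) * M ^ q, min (t₁ - t) (min δ₁ δ₂),
    lt_min (sub_pos.2 ht.2) (lt_min hδ₁ hδ₂), fun h hh hlt => ?_⟩
  obtain ⟨hlt₁, hltδ₁, hltδ₂⟩ : h < t₁ - t ∧ h < δ₁ ∧ h < δ₂ := by simpa using hlt
  have hv : h ^ (1 - η) * M < 2 ^ (-γ) := h₂ (by simpa [abs_of_pos hh] using hltδ₂)
  have hbound := (hf.hasSum_sub ht.1 (by linarith : t ≤ t + h) (by linarith)).norm_le_of_bounded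
    (hsum.hasSum.mul_left (2 ^ (q * γ) * ((h ^ (1 - η) * M) ^ (q - 1) * h ^ (1 - η)))) (by
      intro p
      by_cases hp : p.1.1 ∈ Ioc t (t + h)
      · rw [indicator_of_mem hp, Real.norm_eq_abs, neg_div]
        exact abs_jump_le hη hγ hq (hwM p) hp (by linarith) hv
          (h₁ _ ⟨hp.1, by linarith [hp.2]⟩ (by linarith [hp.2]))
      · rw [indicator_of_notMem hp, norm_zero]
        exact mul_nonneg (by positivity) (pointWeight_nonneg _ _ _ _ _))
  rw [Real.norm_eq_abs, ← hMdef] at hbound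
  refine hbound.trans_eq ?_
  have hsplit : ∀ z : ℝ, 0 ≤ z → z ^ q = z ^ (q - 1) * z := by
    intro z hz
    nth_rw 3 [← Real.rpow_one z]
    rw [← Real.rpow_add_of_nonneg hz (by linarith) zero_le_one, sub_add_cancel]
  rw [Real.rpow_mul hh.le, mul_assoc, mul_assoc, mul_assoc, ← hsplit _ (by positivity)]
  rw [Real.mul_rpow (by positivity) hM0, mul_comm (_ ^ q) (_ ^ q)]

/-! ### Bounded paths, choice of exponents and the bound for all `h` -/

lemma IsCadlagOn.exists_abs_le {t₀ t₁ : ℝ} {f : ℝ → ℝ} (hf : IsCadlagOn t₀ t₁ f) :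
    ∃ B, ∀ u ∈ Ico t₀ t₁, |f u| ≤ B := by
  -- Compactness of `[t₀, t₁]` applies because the left limit at `t₁` exists.
  suffices ∃ B, ∀ u ∈ Icc t₀ t₁ ∩ Ico t₀ t₁, |f u| ≤ B by
    obtain ⟨B, hB⟩ := this
    exact ⟨B, fun u hu => hB u ⟨Ico_subset_Icc_self hu, hu⟩⟩
  refine isCompact_Icc.induction_on (p := fun s => ∃ B, ∀ u ∈ s ∩ Ico t₀ t₁, |f u| ≤ B)
    ⟨0, by simp⟩ ?_ ?_ ?_
  · rintro s s' hss ⟨B, hB⟩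
    exact ⟨B, fun u hu => hB u ⟨hss hu.1, hu.2⟩⟩
  · rintro s s' ⟨B, hB⟩ ⟨B', hB'⟩
    refine ⟨max B B', ?_⟩
    rintro u ⟨hu | hu, hu'⟩
    · exact (hB u ⟨hu, hu'⟩).trans (le_max_left _ _)
    · exact (hB' u ⟨hu, hu'⟩).trans (le_max_right _ _)
  · intro x hx
    have hR : ∃ B, ∀ᶠ u in 𝓝[>] x, u ∈ Ico t₀ t₁ → |f u| ≤ B := by
      rcases hx.2.lt_or_eq with h | h
      · exact ⟨|f x| + 1, ((hf.1 x ⟨hx.1, h⟩).abs.eventually_le_const (lt_add_one _)).mono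
          fun u hu _ => hu⟩
      · exact ⟨0, eventually_nhdsWithin_of_forall fun u hu hu' =>
          absurd hu'.2 (not_lt.2 (h ▸ (mem_Ioi.1 hu).le))⟩
    have hL : ∃ B, ∀ᶠ u in 𝓝[<] x, u ∈ Ico t₀ t₁ → |f u| ≤ B := by
      rcases hx.1.lt_or_eq with h | h
      · obtain ⟨l, hl⟩ := hf.2 x ⟨h, hx.2⟩
        exact ⟨|l| + 1, (hl.abs.eventually_le_const (lt_add_one _)).mono fun u hu _ => hu⟩
      · exact ⟨0, eventually_nhdsWithin_of_forall fun u hu hu' =>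
          absurd hu'.1 (not_le.2 (h ▸ hu))⟩
    obtain ⟨B, hB⟩ := hR
    obtain ⟨B', hB'⟩ := hL
    have hev : ∀ᶠ u in 𝓝 x, u ∈ Ico t₀ t₁ → |f u| ≤ max |f x| (max B B') := by
      rw [← nhdsNE_sup_pure, ← nhdsLT_sup_nhdsGT, eventually_sup, eventually_sup]
      refine ⟨⟨hB'.mono fun u h hu => (h hu).trans (by simp),
        hB.mono fun u h hu => (h hu).trans (by simp)⟩, ?_⟩
      simp
    exact ⟨_, mem_nhdsWithin_of_mem_nhds hev, _, fun u hu => hu.1 hu.2⟩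

/-- Take `q = r / (1 + 1/(n+1))` with `max κ 1 < r < m` and `n` large. Indexing by `n` leaves
countably many weights, hence one null set, although the exponents depend on the path. -/
lemma exists_exponents {κ m : ℝ} (hκ : κ < m) (hm : 1 < m) :
    ∃ n : ℕ, ∃ q : ℝ, 1 ≤ q ∧ q * (1 + 1 / ((n : ℝ) + 1)) < m ∧
      κ ≤ (1 - 1 / ((n : ℝ) + 2)) * q := by
  obtain ⟨r, hr, hrm⟩ := exists_between (max_lt hκ hm)
  obtain ⟨hκr, h1r⟩ := max_lt_iff.1 hr
  have h1 : Tendsto (fun n : ℕ => r / (1 + 1 / ((n : ℝ) + 1))) atTop (𝓝 r) := by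
    have := (tendsto_const_nhds (x := r)).div
      ((tendsto_const_nhds (x := (1 : ℝ))).add tendsto_one_div_add_atTop_nhds_zero_nat) (by simp)
    simpa [Pi.div_def] using this
  have h2 : Tendsto (fun n : ℕ => 1 - 1 / ((n : ℝ) + 2)) atTop (𝓝 1) := by
    have h3 : Tendsto (fun n : ℕ => 1 / ((n : ℝ) + 2)) atTop (𝓝 0) := by
      refine ((tendsto_add_atTop_iff_nat 1).2
        (tendsto_one_div_add_atTop_nhds_zero_nat (𝕜 := ℝ))).congr fun n => ?_
      push_cast
      ring
    simpa using (tendsto_const_nhds (x := (1 : ℝ))).sub h3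
  have h3 := h2.mul h1
  rw [one_mul] at h3
  obtain ⟨n, hn1, hn2⟩ :=
    ((h1.eventually_const_lt h1r).and (h3.eventually_const_lt hκr)).exists
  refine ⟨n, _, hn1.le, ?_, hn2.le⟩
  rwa [div_mul_cancel₀ _ (by positivity)]

lemma SolvesJumpEquation.exists_global_bound {t₀ t₁ a₀ : ℝ} {α : ℝ → ℝ} {S : Set (ℝ × ℝ)}
    {f : ℝ → ℝ} (hf : SolvesJumpEquation t₀ t₁ a₀ α S f) (hc : IsCadlagOn t₀ t₁ f)
    (hα : Continuous α) (hpos : ∀ x, 0 < α x) {t κ : ℝ} (ht : t ∈ Ico t₀ t₁)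
    (hlt : α (f t) < 1) (hκ₀ : 0 ≤ κ) (hκ : κ < 1 / α (f t))
    (hsum : ∀ n : ℕ, Summable fun p : S =>
      pointWeight t t₁ (1 / ((n : ℝ) + 2)) (1 + 1 / ((n : ℝ) + 1)) p) :
    ∃ C, ∀ h, 0 < h → h < t₁ - t → |f (t + h) - f t| ≤ C * h ^ κ := by
  obtain ⟨n, q, hq, hqγ, hκq⟩ := exists_exponents hκ (one_lt_one_div (hpos _) hlt)
  have hη : 1 / ((n : ℝ) + 2) < 1 := by
    rw [div_lt_one (by positivity)]
    linarith [(Nat.cast_nonneg n : (0 : ℝ) ≤ n)]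
  obtain ⟨C, δ, hδ, hC⟩ := hf.exists_local_bound hc hα hpos ht hη
    (by positivity : 0 < 1 + 1 / ((n : ℝ) + 1)) hq hqγ (hsum n)
  obtain ⟨B, hB⟩ := hc.exists_abs_le
  have hB0 : 0 ≤ B := (abs_nonneg _).trans (hB t ht)
  have hδ' : 0 < min δ 1 := lt_min hδ one_pos
  -- The cap at `1` allows the exponent to be lowered to `κ` for small `h`; for larger `h`, `|f(t+h)
  -- - f(t)| ≤ 2B` and `h^κ ≥ (min δ 1)^κ`.
  refine ⟨max |C| (2 * B / (min δ 1) ^ κ), fun h hh hht => ?_⟩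
  rcases lt_or_ge h (min δ 1) with hlt | hge
  · obtain ⟨hhδ, hh1⟩ := lt_min_iff.1 hlt
    calc _ ≤ C * h ^ ((1 - 1 / ((n : ℝ) + 2)) * q) := hC h hh hhδ
      _ ≤ |C| * h ^ κ := mul_le_mul (le_abs_self C)
          (Real.rpow_le_rpow_of_exponent_ge hh hh1.le hκq) (by positivity) (abs_nonneg _)
      _ ≤ _ := by gcongr; exact le_max_left _ _
  · calc _ ≤ |f (t + h)| + |f t| := abs_sub _ _
      _ ≤ B + B := add_le_add (hB _ ⟨by linarith [ht.1], by linarith⟩) (hB t ht)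
      _ = 2 * B / (min δ 1) ^ κ * (min δ 1) ^ κ := by
          rw [div_mul_cancel₀ _ (by positivity), two_mul]
      _ ≤ 2 * B / (min δ 1) ^ κ * h ^ κ := by gcongr
      _ ≤ _ := by gcongr; exact le_max_right _ _

/-! ### Measurability of the constant and conclusion -/

/-- If the right continuous paths of a measurable process satisfy a Hölder bound at `t` with a
random exponent, then the constant can be chosen measurably. -/
lemma exists_measurable_holder_const {Ω : Type*} [MeasurableSpace Ω] {P : Measure Ω}
    {Z : ℝ → Ω → ℝ} {κ : Ω → ℝ} {t t₁ : ℝ} (ht : t < t₁) (hκ : Measurable κ)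
    (hZ : ∀ u ∈ Ico t t₁, Measurable (Z u))
    (hright : ∀ᵐ ω ∂P, ∀ u ∈ Ico t t₁, Tendsto (fun s => Z s ω) (𝓝[>] u) (𝓝 (Z u ω)))
    (hbound : ∀ᵐ ω ∂P, ∃ C, ∀ h, 0 < h → h < t₁ - t → |Z (t + h) ω - Z t ω| ≤ C * h ^ κ ω) :
    ∃ C : Ω → ℝ, Measurable C ∧ (∀ ω, 0 < C ω) ∧
      ∀ᵐ ω ∂P, ∀ h : ℝ, 0 < h → h < t₁ - t → |Z (t + h) ω - Z t ω| ≤ C ω * h ^ κ ω := by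
  let I := {h : ℚ // 0 < (h : ℝ) ∧ (h : ℝ) < t₁ - t}
  let G : Ω → ℝ≥0∞ := fun ω => ⨆ h : I,
    ENNReal.ofReal (|Z (t + (h.1 : ℝ)) ω - Z t ω| / (h.1 : ℝ) ^ κ ω)
  have hG : Measurable G := by
    refine Measurable.iSup fun h => Measurable.ennreal_ofReal ?_
    refine Measurable.div ?_ (measurable_const.pow hκ)
    have h1 := hZ (t + (h.1 : ℝ)) ⟨by linarith [h.2.1], by linarith [h.2.2]⟩
    have h2 := hZ t ⟨le_rfl, ht⟩
    exact (h1.sub h2).abs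
  -- Adding `1` gives positivity everywhere, even where `G = ∞` and `toReal` returns `0`.
  refine ⟨fun ω => 1 + (G ω).toReal, measurable_const.add hG.ennreal_toReal,
    fun ω => by positivity, ?_⟩
  filter_upwards [hright, hbound] with ω hω ⟨C, hC⟩ h hh hht
  have hGtop : G ω ≠ ∞ := by
    refine ((iSup_le fun h => ?_).trans_lt (ENNReal.ofReal_lt_top (r := C))).ne
    refine ENNReal.ofReal_le_ofReal ?_
    rw [div_le_iff₀ (Real.rpow_pos_of_pos h.2.1 _)]
    exact hC _ h.2.1 h.2.2
  have hrat : ∀ r : I, |Z (t + (r.1 : ℝ)) ω - Z t ω| ≤ (1 + (G ω).toReal) * (r.1 : ℝ) ^ κ ω := by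
    intro r
    have hpos := Real.rpow_pos_of_pos r.2.1 (κ ω)
    rw [← div_le_iff₀ hpos]
    have h1 := (ENNReal.ofReal_le_iff_le_toReal hGtop).1
      (le_iSup (fun h : I =>
        ENNReal.ofReal (|Z (t + (h.1 : ℝ)) ω - Z t ω| / (h.1 : ℝ) ^ κ ω)) r)
    linarith
  have hlim1 : Tendsto (fun s => |Z (t + s) ω - Z t ω|) (𝓝[>] h) (𝓝 |Z (t + h) ω - Z t ω|) := by
    have hshift : Tendsto (fun s => t + s) (𝓝[>] h) (𝓝[>] (t + h)) :=
      tendsto_nhdsWithin_iff.2 ⟨((continuous_const_add t).tendsto h).mono_left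
        nhdsWithin_le_nhds, eventually_nhdsWithin_of_forall fun s hs =>
          mem_Ioi.2 ((add_lt_add_iff_left t).2 hs)⟩
    exact ((((hω (t + h) ⟨by linarith, by linarith⟩).comp hshift).sub_const _).abs)
  have hlim2 : Tendsto (fun s : ℝ => (1 + (G ω).toReal) * s ^ κ ω) (𝓝[>] h)
      (𝓝 ((1 + (G ω).toReal) * h ^ κ ω)) :=
    ((Real.continuousAt_rpow_const h (κ ω) (.inl hh.ne')).tendsto.const_mul _).mono_left
      nhdsWithin_le_nhds
  refine le_of_tendsto_of_tendsto_of_frequently hlim1 hlim2 ?_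
  rw [frequently_iff]
  intro U hU
  obtain ⟨v, hv, hsub⟩ := mem_nhdsGT_iff_exists_Ioo_subset.1 hU
  -- Rationals decrease to `h`, the side on which the path is continuous.
  obtain ⟨r, hr1, hr2⟩ := exists_rat_btwn (lt_min (mem_Ioi.1 hv) hht)
  obtain ⟨hrv, hrt⟩ := lt_min_iff.1 hr2
  exact ⟨r, hsub ⟨hr1, hrv⟩, hrat ⟨r, hh.trans hr1, hrt⟩⟩

theorem mainTheorem5 {Ω : Type*} [MeasurableSpace Ω] (P : Measure Ω) [IsProbabilityMeasure P]
    (t₀ t₁ a b a₀ : ℝ) (ht : t₀ < t₁) (ha : 0 < a) (hab : a < b) (hb : b < 1)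
    (α : ℝ → ℝ) (hα_mem : ∀ x, α x ∈ Icc a b) (hα_smooth : ContDiff ℝ 1 α)
    (hα_deriv : ∃ K : ℝ, ∀ x, |deriv α x| ≤ K)
    (X : Ω → Set (ℝ × ℝ))
    (hX : IsPoissonPointProcess P X (Ioo t₀ t₁ ×ˢ (univ : Set ℝ)) volume)
    (Z : ℝ → Ω → ℝ) (hZ : IsSelfStabilizingProcess P t₀ t₁ a₀ α X Z)
    (ε : ℝ) (hε : 0 < ε) (hεb : ε < 1 / b) (t : ℝ) (htmem : t ∈ Ico t₀ t₁) :
    ∃ C : Ω → ℝ, Measurable C ∧ (∀ ω, 0 < C ω) ∧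
      ∀ᵐ ω ∂P, ∀ h : ℝ, 0 < h → h < t₁ - t →
        |Z (t + h) ω - Z t ω| ≤ C ω * h ^ (1 / α (Z t ω) - ε) := by
  have hαc : Continuous α := hα_smooth.continuous
  have hpos : ∀ x, 0 < α x := fun x => ha.trans_le (hα_mem x).1
  have hsum : ∀ᵐ ω ∂P, ∀ n : ℕ, Summable fun p : X ω =>
      pointWeight t t₁ (1 / ((n : ℝ) + 2)) (1 + 1 / ((n : ℝ) + 1)) p :=
    ae_all_iff.2 fun n => ae_summable_pointWeight hX (measurableSet_Ioo.prod .univ)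
      (by positivity) (by linarith [(by positivity : 0 < 1 / ((n : ℝ) + 1))])
  refine exists_measurable_holder_const htmem.2
    ((measurable_const.div (hαc.measurable.comp (hZ.measurable t htmem))).sub_const ε)
    (fun u hu => hZ.measurable u ⟨htmem.1.trans hu.1, hu.2⟩) ?_ ?_
  · filter_upwards [hZ.cadlag] with ω hω u hu using hω.1 u ⟨htmem.1.trans hu.1, hu.2⟩
  · filter_upwards [hZ.cadlag, hZ.solves, hsum] with ω hc hs hω
    refine hs.exists_global_bound hc hαc hpos htmem ((hα_mem _).2.trans_lt hb) ?_
      (sub_lt_self _ hε) hω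
    -- The exponent is nonnegative, since `ε < 1/b ≤ 1/α(Z(t))`.
    have := one_div_le_one_div_of_le (hpos (Z t ω)) (hα_mem _).2
    linarith
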